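/- Call a category $\mathcal K$ finitely concrete if there exists a faithful functor $U:\mathcal K\to\mathbf{Set}$ that preserves directed colimits, i.e. colimits of diagrams indexed by (small, non-empty) directed partially ordered sets. Theorem: the category $\mathbf{CC^*Alg}$, whose objects are the commutative unital (complex) $C^*$-algebras and whose morphisms are the unit-preserving $*$-homomorphisms, is not finitely concrete. -/

import Mathlib

open CategoryTheory CategoryTheory.Limits

universe w v₁ v₂ u₁ u₂ u

/-- A functor preserves (small) directed colimits if it preserves colimits of all diagrams indexed
by a (small) nonempty directed poset. The universe `w` is the universe of the index posets. -/
def PreservesDirectedColimits {C : Type u₁} [Category.{v₁} C] {D : Type u₂} [Category.{v₂} D]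
    (F : C ⥤ D) : Prop :=
  ∀ (J : Type w) [PartialOrder J] [IsDirectedOrder J] [Nonempty J], PreservesColimitsOfShape J F

/-- A category (with `v₁`-small hom-sets) is finitely concrete if it admits a faithful functor into
the category of (`v₁`-small) sets which preserves (`v₁`-small) directed colimits. -/
def FinitelyConcrete (C : Type u₁) [Category.{v₁} C] : Prop :=
  ∃ U : C ⥤ Type v₁, U.Faithful ∧ PreservesDirectedColimits.{v₁} U

/-- The category of commutative unital (complex) C⋆-algebras. -/
structure CommCStarAlgCat : Type (u + 1) where
  /-- The underlying type. -/
  carrier : Type u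
  [commCStarAlgebra : CommCStarAlgebra carrier]

namespace CommCStarAlgCat

attribute [instance] commCStarAlgebra

instance : CoeSort CommCStarAlgCat.{u} (Type u) := ⟨carrier⟩

/-- Morphisms of commutative unital C⋆-algebras: the unital `ℂ`-algebra homomorphisms preserving
the involution. -/
@[ext]
structure Hom (A B : CommCStarAlgCat.{u}) where
  /-- The underlying unital star-homomorphism. -/
  hom' : A →⋆ₐ[ℂ] B

instance : Category CommCStarAlgCat.{u} where
  Hom A B := Hom A B
  id A := ⟨StarAlgHom.id ℂ A⟩
  comp f g := ⟨g.hom'.comp f.hom'⟩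

instance : ConcreteCategory CommCStarAlgCat.{u} (fun A B => A →⋆ₐ[ℂ] B) where
  hom := Hom.hom'
  ofHom := Hom.mk

end CommCStarAlgCat

/-!
By Gelfand duality the category is equivalent to `CompHausᵒᵖ`, so let `U : CompHausᵒᵖ ⥤ Type`
preserve directed colimits, and think of `a ∈ U X` as a section over the compact Hausdorff space
`X`, with a value at each point. A directed intersection of closed subspaces is a directed colimit
in `CompHausᵒᵖ`; since a point is the intersection of its closed neighbourhoods, two sections with
the same value at a point agree near it. Comparing a section with a constant one shows that its
values are locally constant, hence constant if `X = [0, 1]`: `U` identifies all points of `[0, 1]`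
and is not faithful.
-/

open Opposite TopologicalSpace Topology

section FinitelyConcrete

variable {C : Type u₁} [Category.{v₁} C]

theorem PreservesDirectedColimits.comp {D : Type u₂} [Category.{v₂} D] {E : Type*} [Category* E]
    {F : C ⥤ D} {G : D ⥤ E} (hF : PreservesDirectedColimits.{w} F)
    (hG : PreservesDirectedColimits.{w} G) : PreservesDirectedColimits.{w} (F ⋙ G) :=
  fun J _ _ _ =>
    have := hF J
    have := hG J
    inferInstance

variable {D : Type u₂} [Category.{v₁} D]

theorem FinitelyConcrete.of_faithful (F : C ⥤ D) [F.Faithful]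
    (hF : PreservesDirectedColimits.{v₁} F) : FinitelyConcrete D → FinitelyConcrete C
  | ⟨U, _, hU⟩ => ⟨F ⋙ U, inferInstance, hF.comp hU⟩

theorem FinitelyConcrete.of_equivalence (e : C ≌ D) : FinitelyConcrete D → FinitelyConcrete C :=
  .of_faithful e.functor fun _ => inferInstance

end FinitelyConcrete

namespace CommCStarAlgCat

open WeakDual.CharacterSpace

/-- The isomorphism of algebras given by a star-algebra equivalence. -/
def isoOfStarAlgEquiv {A B : CommCStarAlgCat.{u}} (e : A ≃⋆ₐ[ℂ] B) : A ≅ B where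
  hom := ⟨e⟩
  inv := ⟨e.symm⟩
  hom_inv_id := Hom.ext (StarAlgHom.ext e.symm_apply_apply)
  inv_hom_id := Hom.ext (StarAlgHom.ext e.apply_symm_apply)

/-- The contravariant functor `X ↦ C(X, ℂ)` on compact Hausdorff spaces. -/
noncomputable def continuousFunctions : CompHaus.{u}ᵒᵖ ⥤ CommCStarAlgCat.{u} where
  obj X := ⟨C(X.unop, ℂ)⟩
  map f := ⟨f.unop.hom.hom.compStarAlgHom' ℂ ℂ⟩

/-- The contravariant functor taking an algebra to its Gelfand spectrum, the space of characters. -/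
noncomputable def gelfandSpectrum : CommCStarAlgCat.{u} ⥤ CompHaus.{u}ᵒᵖ where
  obj A := op (CompHaus.of (WeakDual.characterSpace ℂ A))
  map φ := (CompHausLike.ofHom _ (compContinuousMap φ.hom')).op

/-- Gelfand duality: the Gelfand transform and the evaluation of functions at points make
`gelfandSpectrum` and `continuousFunctions` inverse equivalences. -/
noncomputable def gelfandDuality : CommCStarAlgCat.{u} ≌ CompHaus.{u}ᵒᵖ :=
  .mk gelfandSpectrum continuousFunctions
    (NatIso.ofComponents (fun A => isoOfStarAlgEquiv (gelfandStarTransform A))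
      fun φ => Hom.ext (gelfandStarTransform_naturality φ.hom'))
    (NatIso.ofComponents (fun X => (CompHausLike.isoOfHomeo (homeoEval X.unop ℂ)).op)
      fun f => Quiver.Hom.unop_inj (ConcreteCategory.hom_ext _ _
        (DFunLike.congr_fun (homeoEval_naturality f.unop.hom.hom))))

end CommCStarAlgCat

section ClosedSubspace

instance {X : Type*} [TopologicalSpace X] [CompactSpace X] (K : Closeds X) : CompactSpace K :=
  isCompact_iff_compactSpace.mp K.isClosed.isCompact

variable {X : CompHaus.{u}}

/-- The inclusion of a closed subspace. -/
def closedIncl (K : Closeds X) : CompHaus.of K ⟶ X :=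
  CompHausLike.ofHom _ ⟨Subtype.val, continuous_subtype_val⟩

instance (K : Closeds X) : Mono (closedIncl K) :=
  (CompHausLike.mono_iff_injective _).mpr Subtype.val_injective

/-- The factorization of a map through a closed subspace containing its range. -/
def closedLift {Y : CompHaus.{u}} (K : Closeds X) (f : Y ⟶ X) (hf : ∀ y, f y ∈ K) :
    Y ⟶ CompHaus.of K :=
  CompHausLike.ofHom _ ⟨fun y => ⟨f y, hf y⟩, f.hom.hom.continuous.subtype_mk hf⟩

theorem closedLift_comp_closedIncl {Y : CompHaus.{u}} (K : Closeds X) (f : Y ⟶ X)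
    (hf : ∀ y, f y ∈ K) : closedLift K f hf ≫ closedIncl K = f :=
  rfl

/-- The inclusion between nested closed subspaces. -/
abbrev closedInclOfLE {K L : Closeds X} (h : K ≤ L) : CompHaus.of K ⟶ CompHaus.of L :=
  closedLift L (closedIncl K) fun x => h x.2

variable {J : Type*} [Preorder J] {F : J → Closeds X}

/-- A decreasing family of closed subspaces, as a diagram in `CompHausᵒᵖ`. -/
def closedDiagram (hF : Antitone F) : J ⥤ CompHaus.{u}ᵒᵖ where
  obj j := op (CompHaus.of (F j))
  map f := (closedInclOfLE (hF (leOfHom f))).op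

/-- The intersection of a decreasing family of closed subspaces, as a cocone in `CompHausᵒᵖ`. -/
def closedCocone (hF : Antitone F) : Cocone (closedDiagram hF) where
  pt := op (CompHaus.of (⨅ j, F j : Closeds X))
  ι := { app j := (closedInclOfLE (iInf_le F j)).op }

variable [IsDirectedOrder J]

theorem unop_app_comp_closedIncl {hF : Antitone F} (s : Cocone (closedDiagram hF)) (i j : J) :
    (s.ι.app i).unop ≫ closedIncl (F i) = (s.ι.app j).unop ≫ closedIncl (F j) := by
  obtain ⟨k, hik, hjk⟩ := exists_ge_ge i j
  rw [← s.w (homOfLE hik), ← s.w (homOfLE hjk)]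
  rfl

/-- A directed intersection of closed subspaces is their colimit in `CompHausᵒᵖ`. -/
noncomputable def isColimitClosedCocone [Nonempty J] (hF : Antitone F) :
    IsColimit (closedCocone hF) :=
  let j₀ : J := Classical.arbitrary J
  { desc s := (closedLift (⨅ j, F j) ((s.ι.app j₀).unop ≫ closedIncl (F j₀)) fun y =>
      Closeds.mem_iInf.mpr fun j => by
        rw [unop_app_comp_closedIncl s j₀ j]
        exact ((s.ι.app j).unop y).2).op
    fac s j := Quiver.Hom.unop_inj <|
      (cancel_mono (closedIncl (F j))).mp (unop_app_comp_closedIncl s j₀ j)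
    uniq s m hm := Quiver.Hom.unop_inj <| (cancel_mono (closedIncl _)).mp <|
      congrArg (fun f => f.unop ≫ closedIncl (F j₀)) (hm j₀) }

end ClosedSubspace

section ClosedNhds

variable {X : Type*} [TopologicalSpace X]

/-- The closed neighbourhoods of a point, ordered by inclusion. -/
abbrev ClosedNhds (x : X) : Type _ :=
  {K : Closeds X // (K : Set X) ∈ 𝓝 x}

instance (x : X) : Nonempty (ClosedNhds x) :=
  ⟨⟨⊤, Filter.univ_mem⟩⟩

instance (x : X) : IsCodirectedOrder (ClosedNhds x) where
  directed K L := ⟨⟨K.1 ⊓ L.1, Filter.inter_mem K.2 L.2⟩, fun _ h => h.1, fun _ h => h.2⟩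

theorem iInf_closedNhds_eq_singleton [T2Space X] (x : X) : ⨅ K : ClosedNhds x, K.1 = {x} := by
  refine le_antisymm (fun y hy => ?_) (le_iInf fun K => ?_)
  · by_contra hyx
    obtain ⟨V, W, hV, hW, hyV, hxW, hVW⟩ := t2_separation hyx
    let K : ClosedNhds x := ⟨⟨Vᶜ, hV.isClosed_compl⟩,
      Filter.mem_of_superset (hW.mem_nhds hxW) hVW.subset_compl_left⟩
    exact Closeds.mem_iInf.mp hy K hyV
  · rintro _ rfl
    exact mem_of_mem_nhds K.2

end ClosedNhds

section Points

variable {U : CompHaus.{u}ᵒᵖ ⥤ Type u} {X : CompHaus.{u}}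

/-- A point of a space, as a map from the one-point space. -/
abbrev point (x : X) : CompHaus.of PUnit.{u + 1} ⟶ X :=
  CompHausLike.const _ x

theorem map_closedLift_map_closedIncl {Y : CompHaus.{u}} (K : Closeds X) (f : Y ⟶ X)
    (hf : ∀ y, f y ∈ K) (a : U.obj (op X)) :
    U.map (closedLift K f hf).op (U.map (closedIncl K).op a) = U.map f.op a := by
  rw [← U.map_comp_apply, ← op_comp, closedLift_comp_closedIncl]

theorem exists_map_closedIncl_eq (hU : PreservesDirectedColimits.{u} U) {J : Type u}
    [PartialOrder J] [IsDirectedOrder J] [Nonempty J] {F : J → Closeds X} (hF : Antitone F)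
    {a b : U.obj (op X)}
    (h : U.map (closedIncl (⨅ j, F j)).op a = U.map (closedIncl (⨅ j, F j)).op b) :
    ∃ j, U.map (closedIncl (F j)).op a = U.map (closedIncl (F j)).op b := by
  have := hU J
  let j₀ : J := Classical.arbitrary J
  have hcolim := isColimitOfPreserves U (isColimitClosedCocone hF)
  have hrestrict {K : Closeds X} (hK : K ≤ F j₀) (c : U.obj (op X)) :
      U.map (closedInclOfLE hK).op (U.map (closedIncl (F j₀)).op c) = U.map (closedIncl K).op c :=
    map_closedLift_map_closedIncl ..
  obtain ⟨j, f, hj⟩ := (Types.FilteredColimit.isColimit_eq_iff' hcolim _ _).mp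
    ((hrestrict (iInf_le F j₀) a).trans (h.trans (hrestrict (iInf_le F j₀) b).symm))
  have hle : F j ≤ F j₀ := hF (leOfHom f)
  exact ⟨j, (hrestrict hle a).symm.trans (hj.trans (hrestrict hle b))⟩

theorem eventually_map_point_eq (hU : PreservesDirectedColimits.{u} U) {x : X}
    {a b : U.obj (op X)} (h : U.map (point x).op a = U.map (point x).op b) :
    ∀ᶠ y in 𝓝 x, U.map (point y).op a = U.map (point y).op b := by
  let F (K : (ClosedNhds x)ᵒᵈ) : Closeds X := K.ofDual.1
  have hF : Antitone F := fun _ _ hKL => hKL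
  have hfac : closedIncl (⨅ K, F K) = CompHausLike.const _ PUnit.unit ≫ point x := by
    ext y
    exact (iInf_closedNhds_eq_singleton x).le y.2
  obtain ⟨K, hK⟩ := exists_map_closedIncl_eq hU hF (a := a) (b := b) <| by
    rw [hfac, op_comp, U.map_comp_apply, U.map_comp_apply, h]
  filter_upwards [K.ofDual.2] with y hy
  have hpoint (c : U.obj (op X)) := map_closedLift_map_closedIncl (F K) (point y) (fun _ => hy) c
  rw [← hpoint a, hK, hpoint b]

theorem isLocallyConstant_map_point (hU : PreservesDirectedColimits.{u} U) (a : U.obj (op X)) :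
    IsLocallyConstant fun x : X => U.map (point x).op a := by
  refine (IsLocallyConstant.iff_eventually_eq _).mpr fun x => ?_
  let b : U.obj (op X) := U.map (X.const PUnit.unit ≫ point x).op a
  have hb (y : X) : U.map (point y).op b = U.map (point x).op a := (U.map_comp_apply ..).symm
  filter_upwards [eventually_map_point_eq hU (hb x).symm] with y hy
  exact hy.trans (hb y)

theorem map_point_eq_map_point [PreconnectedSpace X] (hU : PreservesDirectedColimits.{u} U)
    (x y : X) : U.map (point x).op = U.map (point y).op := by
  ext a
  exact (isLocallyConstant_map_point hU a).apply_eq_of_preconnectedSpace x y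

end Points

theorem not_finitelyConcrete_compHaus_op : ¬ FinitelyConcrete CompHaus.{u}ᵒᵖ := by
  rintro ⟨U, _, hU⟩
  let X := CompHaus.of (ULift.{u} unitInterval)
  have : PreconnectedSpace X :=
    Homeomorph.ulift.symm.surjective.denseRange.preconnectedSpace Homeomorph.ulift.symm.continuous
  have h : point (X := X) (.up 0) = point (X := X) (.up 1) :=
    Quiver.Hom.op_inj (U.map_injective (map_point_eq_map_point hU _ _))
  exact zero_ne_one (congrArg ULift.down (ConcreteCategory.congr_hom h PUnit.unit))

theorem theorem3p2 : ¬ FinitelyConcrete CommCStarAlgCat.{u} := fun h =>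
  not_finitelyConcrete_compHaus_op (h.of_equivalence CommCStarAlgCat.gelfandDuality.symm)
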